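/- Let $D=\{z\in\mathbb R^2 : |z|<1\}$ be the Beltrami–Klein model of the hyperbolic plane and $S^1$ the unit circle. For $P\neq Q$ in $D$ let $v_1,v_2\in S^1$ be the two points in which the line $PQ$ meets $S^1$, and put $d'(P,Q)=\frac12\left|\log\frac{|v_1Q|\,|v_2P|}{|v_1P|\,|v_2Q|}\right|$; put $d'(P,P)=0$. Let $\Delta_2'(P,Q)=\log\frac{e^{2d'(P,Q)}+1}{e^{2d'(P,Q)}-1}$, and let $\delta(P,Q,R)$ be the minimum of $d'(R,S)$ over the points $S$ of $D$ on the line $PQ$. For a nonempty closed convex set $U\subset D$ and $v\in S^1$, let $\theta(v)$ be the minimum over $u\in U$ of the gradient of the line $uv$ in the coordinates given by the basis $\{v,\mathcal R v\}$ of $\mathbb R^2$, where $\mathcal R$ is the counterclockwise rotation by $\pi/2$, and let $\psi_U(v)$ be the point of $S^1$, other than $v$, on the line through $v$ with gradient $\theta(v)$ in these coordinates. (Thus $\psi_U(v)$ is the other end of the chord from $v$ tangent to $U$ whose end is nearest to $v$ counterclockwise.) For an orientation preserving homeomorphism $f$ of $S^1=\mathbb R/\mathbb Z$, let $\overline f:\mathbb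 R\to\mathbb R$ be the lift of $f$ with $\overline f(0)\in[0,1)$, and let $\rho(f)=\lim_{n\to\infty}\frac{\overline f^{\,n}(x)-x}{n}$ (which does not depend on $x\in\mathbb R$) be its rotation number. **Theorem.** Let $PQR$ be a nondegenerate triangle in $D$ with $d'(P,R)=d'(Q,R)$ and $d'(P,Q)>\log 3$. If $\delta(P,Q,R)<\Delta_2'(P,Q)$, then $\psi_{\triangle PQR}$, the map for the (full) triangle with vertices $P$, $Q$, $R$, is an orientation preserving homeomorphism of $S^1$ and $\rho(\psi_{\triangle PQR})>\frac25$. -/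

import Mathlib

open Set Filter Topology

noncomputable section

namespace BarBilliard

/-! The Euclidean plane is `ℂ`, the unit circle is Mathlib's `Circle`. -/

/-- The open unit disk, carrying the Beltrami-Klein model of the hyperbolic plane. -/
def disk : Set ℂ := Metric.ball 0 1

/-! ### The Klein metric -/

/-- The end, on the side of `Q`, of the chord of the unit circle through `P` and `Q`: the point
`P + t (Q - P)`, where `t` is the larger root of the equation `‖P + t (Q - P)‖ ^ 2 = 1`.
Meaningful for `P ≠ Q` in the disk. -/
def idealEnd (P Q : ℂ) : ℂ :=
  let a : ℝ := ‖Q - P‖ ^ 2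
  let b : ℝ := inner ℝ P (Q - P)
  let c : ℝ := ‖P‖ ^ 2 - 1
  P + (((-b + √(b ^ 2 - a * c)) / a : ℝ) : ℂ) * (Q - P)

/-- For `P ≠ Q` in the disk, `idealEnd P Q` is a point of the unit circle lying on the ray from
`P` through `Q`. Exchanging `P` and `Q` gives the other end of the chord. -/
theorem idealEnd_spec {P Q : ℂ} (hP : P ∈ disk) (hPQ : P ≠ Q) :
    ‖idealEnd P Q‖ = 1 ∧ ∃ t : ℝ, 0 < t ∧ idealEnd P Q = P + (t : ℂ) * (Q - P) := by
  have hP1 : ‖P‖ < 1 := by simpa [disk] using hP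
  have ha : 0 < ‖Q - P‖ ^ 2 := by
    have : 0 < ‖Q - P‖ := norm_pos_iff.2 (sub_ne_zero.2 hPQ.symm)
    positivity
  have hc : ‖P‖ ^ 2 - 1 < 0 := by nlinarith [norm_nonneg P]
  set a : ℝ := ‖Q - P‖ ^ 2 with hadef
  set b : ℝ := inner ℝ P (Q - P) with hbdef
  set c : ℝ := ‖P‖ ^ 2 - 1 with hcdef
  have hac : 0 < -(a * c) := by nlinarith
  have hD : b ^ 2 < b ^ 2 - a * c := by linarith
  have hD0 : 0 ≤ b ^ 2 - a * c := by nlinarith [sq_nonneg b]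
  have hs := Real.sq_sqrt hD0
  have hlt : b < √(b ^ 2 - a * c) := by
    calc b ≤ |b| := le_abs_self b
      _ = √(b ^ 2) := (Real.sqrt_sq_eq_abs b).symm
      _ < _ := Real.sqrt_lt_sqrt (sq_nonneg b) hD
  set s : ℝ := √(b ^ 2 - a * c) with hsdef
  have hE : idealEnd P Q = P + (((-b + s) / a : ℝ) : ℂ) * (Q - P) := rfl
  set t : ℝ := (-b + s) / a with ht
  refine ⟨?_, t, div_pos (by linarith) ha, hE⟩
  have hta : t * a = -b + s := by rw [ht]; field_simp
  have h1 : ‖P + (t : ℂ) * (Q - P)‖ ^ 2 = ‖P‖ ^ 2 + 2 * (t * b) + t ^ 2 * a := by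
    rw [← Complex.real_smul, norm_add_sq_real, inner_smul_right, norm_smul, mul_pow,
      Real.norm_eq_abs, sq_abs]
  have h2 : a * (c + 2 * (t * b) + t ^ 2 * a) = 0 := by
    have : a * (c + 2 * (t * b) + t ^ 2 * a) = a * c + 2 * (t * a) * b + (t * a) ^ 2 := by ring
    rw [this, hta]; nlinarith
  have h3 : c + 2 * (t * b) + t ^ 2 * a = 0 := by
    rcases mul_eq_zero.1 h2 with h | h
    · exact absurd h ha.ne'
    · exact h
  have h4 : ‖idealEnd P Q‖ ^ 2 = 1 := by rw [hE, h1]; linarith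
  nlinarith [norm_nonneg (idealEnd P Q)]

/-- The Beltrami-Klein distance
`(1 / 2) |log ((|v₁Q| |v₂P|) / (|v₁P| |v₂Q|))|`, where `v₁`, `v₂` are the ends of the line `PQ`;
it is `0` for `P = Q`. -/
def kleinDist (P Q : ℂ) : ℝ :=
  if P = Q then 0 else
    let v₁ := idealEnd Q P
    let v₂ := idealEnd P Q
    1 / 2 * |Real.log (dist v₁ Q * dist v₂ P / (dist v₁ P * dist v₂ Q))|

/-- `Δₙ'(P, Q) = log ((e ^ (n d'(P, Q)) + 1) / (e ^ (n d'(P, Q)) - 1))`, for `n ≥ 1` and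
`P ≠ Q`. -/
def Delta (n : ℕ) (P Q : ℂ) : ℝ :=
  Real.log ((Real.exp (n * kleinDist P Q) + 1) / (Real.exp (n * kleinDist P Q) - 1))

/-- `δ(P, Q, R)`: the Klein distance from `R` to the hyperbolic line through `P` and `Q`. -/
def distToLine (P Q R : ℂ) : ℝ :=
  sInf (kleinDist R '' ((line[ℝ, P, Q] : Set ℂ) ∩ disk))

/-! ### The bar billiard map -/

/-- The gradient of the line through `u` and `v` in the coordinates given by the basis `v, i v`
of the plane. In these coordinates `u` is `(re (u v̄), im (u v̄))` and `v` is `(1, 0)`. -/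
def chordGradient (u : ℂ) (v : Circle) : ℝ :=
  (u * starRingEnd ℂ (v : ℂ)).im / ((u * starRingEnd ℂ (v : ℂ)).re - 1)

/-- The least gradient of a line joining `v` to a point of `U` (a minimum if `U` is nonempty,
compact and contained in the disk). -/
def minGradient (U : Set ℂ) (v : Circle) : ℝ :=
  sInf ((fun u => chordGradient u v) '' U)

theorem norm_secondPoint (v : Circle) (θ : ℝ) :
    ‖(v : ℂ) + ((-2 / (1 + θ ^ 2) : ℝ) : ℂ) * (v + θ * (Complex.I * v))‖ = 1 := by
  have h : (v : ℂ) + ((-2 / (1 + θ ^ 2) : ℝ) : ℂ) * (v + θ * (Complex.I * v)) =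
      v * (1 + ((-2 / (1 + θ ^ 2) : ℝ) : ℂ) * (1 + θ * Complex.I)) := by ring
  rw [h, norm_mul, Circle.norm_coe, one_mul]
  have hpos : (1 + θ ^ 2) ≠ 0 := by positivity
  have h2 : ‖1 + ((-2 / (1 + θ ^ 2) : ℝ) : ℂ) * (1 + θ * Complex.I)‖ ^ 2 = 1 := by
    rw [← Complex.normSq_eq_norm_sq, Complex.normSq_apply]
    simp only [Complex.add_re, Complex.add_im, Complex.one_re, Complex.one_im,
      Complex.re_ofReal_mul, Complex.im_ofReal_mul, Complex.I_re, Complex.I_im]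
    field_simp
    ring
  nlinarith [norm_nonneg (1 + ((-2 / (1 + θ ^ 2) : ℝ) : ℂ) * (1 + θ * Complex.I))]

/-- The point, other than `v`, in which the line through `v` with gradient `θ` in the basis
`v, i v` meets the unit circle. -/
def secondPoint (v : Circle) (θ : ℝ) : Circle :=
  ⟨(v : ℂ) + ((-2 / (1 + θ ^ 2) : ℝ) : ℂ) * (v + θ * (Complex.I * v)),
    mem_sphere_zero_iff_norm.2 (norm_secondPoint v θ)⟩

/-- The bar billiard map `ψ_U` of the circle: it sends `v` to the other end of the chord from `v`
tangent to `U` whose end is nearest to `v` counterclockwise. -/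
def billiardMap (U : Set ℂ) (v : Circle) : Circle :=
  secondPoint v (minGradient U v)

/-! ### The rotation number -/

/-- `F` is the lift with `F 0 ∈ [0, 1)`, for the covering `x ↦ exp (2 π i x)` of the circle, of
the orientation preserving homeomorphism `f` of the circle. -/
structure IsNormalizedLift (f : Circle → Circle) (F : ℝ → ℝ) : Prop where
  continuous : Continuous F
  strictMono : StrictMono F
  map_add_one : ∀ x, F (x + 1) = F x + 1
  map_zero_mem : F 0 ∈ Ico (0 : ℝ) 1
  semiconj : ∀ x, Circle.exp (2 * Real.pi * F x) = f (Circle.exp (2 * Real.pi * x))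

/-- `f` is an orientation preserving homeomorphism of the circle with rotation number `ρ`: it has
a normalized lift `F`, and `(F ^ n (x) - x) / n → ρ` for every real `x`. -/
def HasRotationNumber (f : Circle → Circle) (ρ : ℝ) : Prop :=
  ∃ F : ℝ → ℝ, IsNormalizedLift f F ∧
    ∀ x : ℝ, Tendsto (fun n : ℕ => (F^[n] x - x) / n) atTop (𝓝 ρ)

/-- The rotation number is unique. -/
theorem HasRotationNumber.unique {f : Circle → Circle} {a b : ℝ}
    (ha : HasRotationNumber f a) (hb : HasRotationNumber f b) : a = b := by
  obtain ⟨F, hF, hFa⟩ := ha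
  obtain ⟨G, hG, hGb⟩ := hb
  have key : ∀ x, ∃ n : ℤ, F x - G x = n := by
    intro x
    have h := (hF.semiconj x).trans (hG.semiconj x).symm
    obtain ⟨m, hm⟩ := Circle.exp_eq_exp.1 h
    refine ⟨m, ?_⟩
    have : (2 * Real.pi) * (F x - G x - m) = 0 := by linear_combination hm
    have h2 : 2 * Real.pi ≠ 0 := by positivity
    have := (mul_eq_zero.1 this).resolve_left h2
    linarith
  choose n hn using key
  have hc : Continuous n := by
    have : Continuous (fun x => ((n x : ℤ) : ℝ)) := by
      have h : Continuous fun x => F x - G x := hF.continuous.sub hG.continuous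
      simpa only [hn] using h
    exact Int.isClosedEmbedding_coe_real.isEmbedding.continuous_iff.2 this
  have hn0 : n 0 = 0 := by
    have h1 := hF.map_zero_mem; have h2 := hG.map_zero_mem
    have h3 := hn 0
    have : (-1 : ℝ) < n 0 := by linarith [h1.1, h2.2]
    have h5 : (n 0 : ℝ) < 1 := by linarith [h1.2, h2.1]
    have h6 : -1 < n 0 := by exact_mod_cast this
    have h7 : n 0 < 1 := by exact_mod_cast h5
    omega
  have hFG : F = G := by
    funext x
    have h1 := hn x
    rw [PreconnectedSpace.constant inferInstance hc (x := x) (y := 0), hn0] at h1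
    simpa [sub_eq_zero] using h1
  subst hFG
  exact tendsto_nhds_unique (hFa 0) (hGb 0)

end BarBilliard

end

/-! Exchanging the ends of each chord through `u` is the action on the ideal circle of the
hyperbolic half-turn about `u`. Its lift `pointLift u` is increasing and squares to `x ↦ x + 1`. A
tangent chord of least gradient passes through a vertex, so the lift of the billiard map is the
pointwise minimum of the lifts of the half-turns about `P`, `Q`, `R`. Hence its fifth iterate at `x`
is the value at `x` of some word of length five in these half-turns, and it suffices that every such
word moves every point by more than two turns.

Up to cyclic rotation (a conjugation), a word of length five in three letters either has two equal
adjacent letters, which contribute a whole turn and leave a word of length three, or is `a b c b c`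
(`add_two_lt_word`). Evaluated at an end of the chord through `b` and `c`, the words `a b c` and `a
b c b c` exceed one and two turns respectively. By continuity they do so everywhere once the Möbius
transformation has no fixed point on the circle, that is, once it is elliptic: trace squared less
than four times the determinant. For `a b c b c` this is `IsLow b c a`, which also implies the
condition for `a b c`.

For the base `PQ`, `IsLow` is the hypothesis `δ < Δ₂'` written with the Lorentz form
(`isLow_of_distToLine_lt`). It passes to shorter sides (`IsLow.leg`), and in an isosceles triangle
with base longer than `log 3` it forces the legs to be no longer than the base (`leg_le_base`). So
all three sides are low. -/

noncomputable section

namespace BarBilliard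

open ComplexConjugate

/-! ### The Klein metric in terms of the Lorentz form -/

/-- The Lorentz form `1 - ⟨P, Q⟩` of the points `(1, P)` and `(1, Q)` of Minkowski space. -/
def lorentz (P Q : ℂ) : ℝ := 1 - (P * conj Q).re

/-- The determinant of the points `(1, P)`, `(1, Q)`, `(1, R)` of Minkowski space, which is twice
the signed area of the triangle. -/
def triangleDet (P Q R : ℂ) : ℝ := (Q * conj R - P * conj R + P * conj Q).im

theorem lorentz_eq (P Q : ℂ) : lorentz P Q = 1 - (P.re * Q.re + P.im * Q.im) := by
  simp [lorentz]

theorem lorentz_comm (P Q : ℂ) : lorentz P Q = lorentz Q P := by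
  rw [lorentz_eq, lorentz_eq]; ring

theorem triangleDet_eq (P Q R : ℂ) : triangleDet P Q R =
    (Q.im * R.re - Q.re * R.im) - (P.im * R.re - P.re * R.im) + (P.im * Q.re - P.re * Q.im) := by
  simp [triangleDet]; ring

theorem lorentz_self (P : ℂ) : lorentz P P = 1 - ‖P‖ ^ 2 := by
  rw [lorentz_eq, ← Complex.normSq_eq_norm_sq, Complex.normSq_apply]

theorem lorentz_self_pos {P : ℂ} (hP : P ∈ disk) : 0 < lorentz P P := by
  have h : ‖P‖ < 1 := by simpa [disk] using hP
  rw [lorentz_self]; nlinarith [norm_nonneg P]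

theorem lorentz_pos {P Q : ℂ} (hP : P ∈ disk) (hQ : Q ∈ disk) : 0 < lorentz P Q := by
  have h1 := lorentz_self_pos hP
  have h2 := lorentz_self_pos hQ
  rw [lorentz_eq] at *
  nlinarith [sq_nonneg (P.re - Q.re), sq_nonneg (P.im - Q.im)]

theorem lorentz_mul_self_le (P Q : ℂ) (hP : P ∈ disk) :
    lorentz P P * lorentz Q Q ≤ lorentz P Q ^ 2 := by
  have h1 := lorentz_self_pos hP
  have key : lorentz P Q ^ 2 - lorentz P P * lorentz Q Q =
      lorentz P P * ((P.re - Q.re) ^ 2 + (P.im - Q.im) ^ 2) +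
        ((P.re - Q.re) * P.re + (P.im - Q.im) * P.im) ^ 2 := by
    simp only [lorentz_eq]; ring
  have : 0 ≤ lorentz P Q ^ 2 - lorentz P P * lorentz Q Q := by rw [key]; positivity
  linarith

/-- The Gram determinant of three points of Minkowski space. -/
theorem triangleDet_sq (P Q R : ℂ) : triangleDet P Q R ^ 2 =
    lorentz P P * lorentz Q Q * lorentz R R + 2 * lorentz P Q * lorentz P R * lorentz Q R
      - lorentz P P * lorentz Q R ^ 2 - lorentz Q Q * lorentz P R ^ 2
      - lorentz R R * lorentz P Q ^ 2 := by
  simp only [lorentz_eq, triangleDet_eq]; ring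

/-- If `P + t (Q - P)` is on the unit circle, then `t` is a root of a quadratic polynomial. -/
theorem quadratic_of_norm_eq_one {P Q : ℂ} {t : ℝ} (h : ‖P + (t : ℂ) * (Q - P)‖ = 1) :
    ‖Q - P‖ ^ 2 * t ^ 2 + 2 * (lorentz P P - lorentz P Q) * t = lorentz P P := by
  have h1 : ‖P + (t : ℂ) * (Q - P)‖ ^ 2 = 1 := by rw [h]; norm_num
  rw [← Complex.normSq_eq_norm_sq, Complex.normSq_apply] at *
  simp [lorentz_eq] at *
  linear_combination h1

theorem norm_sub_sq_eq_lorentz (P Q : ℂ) :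
    ‖Q - P‖ ^ 2 = 2 * lorentz P Q - lorentz P P - lorentz Q Q := by
  rw [← Complex.normSq_eq_norm_sq, Complex.normSq_apply]
  simp [lorentz_eq]; ring

theorem kleinDist_self (P : ℂ) : kleinDist P P = 0 := by simp [kleinDist]

theorem kleinDist_nonneg (P Q : ℂ) : 0 ≤ kleinDist P Q := by
  unfold kleinDist
  split_ifs
  · rfl
  · positivity

theorem one_lt_of_quadratic {P Q : ℂ} (hP : P ∈ disk) (hQ : Q ∈ disk) {t : ℝ} (ht : 0 < t)
    (h : ‖Q - P‖ ^ 2 * t ^ 2 + 2 * (lorentz P P - lorentz P Q) * t = lorentz P P) : 1 < t := by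
  have h1 := lorentz_self_pos hP
  have h2 := lorentz_self_pos hQ
  have ha := norm_sub_sq_eq_lorentz P Q
  have ha0 : 0 ≤ ‖Q - P‖ ^ 2 := by positivity
  by_contra! hlt
  -- The left side is `1 - ‖P + t (Q - P)‖ ^ 2`, which is positive on the segment from `P` to `Q` by
  -- convexity.
  have : (1 - t) * lorentz P P + t * lorentz Q Q + ‖Q - P‖ ^ 2 * (t * (1 - t)) = 0 := by
    linear_combination (-1 : ℝ) * h + t * ha
  have h3 : 0 ≤ (1 - t) * lorentz P P := mul_nonneg (by linarith) h1.le
  have h4 : 0 < t * lorentz Q Q := mul_pos ht h2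
  have h5 : 0 ≤ ‖Q - P‖ ^ 2 * (t * (1 - t)) :=
    mul_nonneg ha0 (mul_nonneg ht.le (by linarith))
  linarith

theorem cosh_sq_half_log {x : ℝ} (hx : 0 < x) :
    Real.cosh (1 / 2 * |Real.log x|) ^ 2 * (4 * x) = (x + 1) ^ 2 := by
  have h2 : Real.cosh (2 * (1 / 2 * |Real.log x|)) = (x + x⁻¹) / 2 := by
    rw [show 2 * (1 / 2 * |Real.log x|) = |Real.log x| by ring, Real.cosh_abs, Real.cosh_log hx]
  rw [Real.cosh_two_mul, Real.sinh_sq] at h2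
  have h3 : Real.cosh (1 / 2 * |Real.log x|) ^ 2 = ((x + x⁻¹) / 2 + 1) / 2 := by linarith
  rw [h3]; field_simp; ring

/-- The hyperbolic cosine of the Klein distance. -/
theorem cosh_kleinDist_sq {P Q : ℂ} (hP : P ∈ disk) (hQ : Q ∈ disk) :
    Real.cosh (kleinDist P Q) ^ 2 * (lorentz P P * lorentz Q Q) = lorentz P Q ^ 2 := by
  rcases eq_or_ne P Q with rfl | hne
  · simp [kleinDist_self]; ring
  obtain ⟨hn1, t, ht, h1⟩ := idealEnd_spec hQ hne.symm
  obtain ⟨hn2, s, hs, h2⟩ := idealEnd_spec hP hne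
  rw [h1] at hn1
  rw [h2] at hn2
  have q1 := quadratic_of_norm_eq_one hn1
  have q2 := quadratic_of_norm_eq_one hn2
  have ht1 := one_lt_of_quadratic hQ hP ht q1
  have hs1 := one_lt_of_quadratic hP hQ hs q2
  have ha : 0 < ‖Q - P‖ := norm_pos_iff.2 (sub_ne_zero.2 hne.symm)
  have d1 : dist (idealEnd Q P) Q = t * ‖Q - P‖ := by
    rw [h1, dist_eq_norm, show Q + (t : ℂ) * (P - Q) - Q = -((t : ℂ) * (Q - P)) by ring,
      norm_neg, norm_mul, Complex.norm_real, Real.norm_of_nonneg ht.le]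
  have d2 : dist (idealEnd P Q) P = s * ‖Q - P‖ := by
    rw [h2, dist_eq_norm, show P + (s : ℂ) * (Q - P) - P = (s : ℂ) * (Q - P) by ring,
      norm_mul, Complex.norm_real, Real.norm_of_nonneg hs.le]
  have d3 : dist (idealEnd Q P) P = (t - 1) * ‖Q - P‖ := by
    rw [h1, dist_eq_norm, show Q + (t : ℂ) * (P - Q) - P = -(((t - 1 : ℝ) : ℂ) * (Q - P)) by
      push_cast; ring, norm_neg, norm_mul, Complex.norm_real, Real.norm_of_nonneg (by linarith)]
  have d4 : dist (idealEnd P Q) Q = (s - 1) * ‖Q - P‖ := by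
    rw [h2, dist_eq_norm, show P + (s : ℂ) * (Q - P) - Q = ((s - 1 : ℝ) : ℂ) * (Q - P) by
      push_cast; ring, norm_mul, Complex.norm_real, Real.norm_of_nonneg (by linarith)]
  have hk : kleinDist P Q = 1 / 2 * |Real.log (t * s / ((t - 1) * (s - 1)))| := by
    have : t * ‖Q - P‖ * (s * ‖Q - P‖) / ((t - 1) * ‖Q - P‖ * ((s - 1) * ‖Q - P‖)) =
        t * s / ((t - 1) * (s - 1)) := by
      have : t - 1 ≠ 0 := by linarith
      have : s - 1 ≠ 0 := by linarith
      field_simp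
    simp only [kleinDist, if_neg hne]
    rw [d1, d2, d3, d4, this]
  have ht0 : 0 < t - 1 := by linarith
  have hs0 : 0 < s - 1 := by linarith
  have hc := cosh_sq_half_log (x := t * s / ((t - 1) * (s - 1))) (by positivity)
  rw [← hk] at hc
  set c := Real.cosh (kleinDist P Q) ^ 2
  have hc' : c * (4 * (t * s) * ((t - 1) * (s - 1))) = (t * s + (t - 1) * (s - 1)) ^ 2 := by
    field_simp at hc
    linear_combination hc
  have e1 := norm_sub_sq_eq_lorentz P Q
  rw [norm_sub_rev, lorentz_comm Q P] at q1
  set a := ‖Q - P‖ ^ 2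
  -- Power of the point `P`: its distances `(t - 1) ‖Q - P‖` and `s ‖Q - P‖` to the two ends
  -- multiply to `1 - ‖P‖ ^ 2`. The extra factor `t + s - 1` is the chord length divided by `‖Q -
  -- P‖`. `w0` is the same for `Q`.
  have v0 : (a * ((t - 1) * s) - lorentz P P) * (t + s - 1) = 0 := by
    linear_combination s * q1 + (t - 1) * q2 + (s - 2 * s * t) * e1
  have v1 : a * ((t - 1) * s) = lorentz P P := by
    have := (mul_eq_zero.1 v0).resolve_right (by linarith)
    linarith
  have w0 : (a * ((s - 1) * t) - lorentz Q Q) * (t + s - 1) = 0 := by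
    linear_combination (s - 1) * q1 + t * q2 + (t - 2 * s * t) * e1
  have w1 : a * ((s - 1) * t) = lorentz Q Q := by
    have := (mul_eq_zero.1 w0).resolve_right (by linarith)
    linarith
  have u1 : a * (t * s + (t - 1) * (s - 1)) = 2 * lorentz P Q := by
    linear_combination v1 + w1 + e1
  rw [← v1, ← w1]
  have : 4 * (c * (a * ((t - 1) * s) * (a * ((s - 1) * t)))) = 4 * lorentz P Q ^ 2 := by
    linear_combination a ^ 2 * hc' + (a * (t * s + (t - 1) * (s - 1)) + 2 * lorentz P Q) * u1
  linarith

/-- `4 ⟨P, Q⟩² det(P, Q, R)² < ⟨P, P⟩² ⟨Q, Q⟩² ⟨R, R⟩`: in hyperbolic terms,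
`sinh (2 d(P, Q)) sinh δ(P, Q, R) < 1`. -/
def IsLow (P Q R : ℂ) : Prop :=
  4 * lorentz P Q ^ 2 * triangleDet P Q R ^ 2 < lorentz P P ^ 2 * lorentz Q Q ^ 2 * lorentz R R

/-- A lower bound for the distance from `R` to a point `S` of the line `PQ`. -/
theorem triangleDet_sq_mul_le {P Q R S : ℂ} (hS : S ∈ line[ℝ, P, Q]) :
    triangleDet P Q R ^ 2 * lorentz S S ≤
      (lorentz R S ^ 2 - lorentz R R * lorentz S S) *
        (lorentz P Q ^ 2 - lorentz P P * lorentz Q Q) := by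
  obtain ⟨t, rfl⟩ := mem_affineSpan_pair_iff_exists_lineMap_eq.1 hS
  rw [AffineMap.lineMap_apply]
  set S := t • (Q -ᵥ P) +ᵥ P with hSdef
  have hre : S.re = t * (Q.re - P.re) + P.re := by simp [hSdef]
  have him : S.im = t * (Q.im - P.im) + P.im := by simp [hSdef]
  -- The final square vanishes when `S` is the foot of the perpendicular from `R`; only its sign is
  -- needed.
  have key : (lorentz R S ^ 2 - lorentz R R * lorentz S S) *
        (lorentz P Q ^ 2 - lorentz P P * lorentz Q Q) = triangleDet P Q R ^ 2 * lorentz S S +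
        (lorentz R P * lorentz S Q - lorentz R Q * lorentz S P) ^ 2 := by
    simp only [lorentz_eq, triangleDet_eq, hre, him]; ring
  rw [key]
  linarith [sq_nonneg (lorentz R P * lorentz S Q - lorentz R Q * lorentz S P)]

theorem sinh_Delta_two {P Q : ℂ} (h : 0 < kleinDist P Q) :
    Real.sinh (Delta 2 P Q) * Real.sinh (2 * kleinDist P Q) = 1 := by
  have h1 : 1 < Real.exp (2 * kleinDist P Q) := Real.one_lt_exp_iff.2 (by linarith)
  rw [Delta, Real.sinh_log (div_pos (by positivity) (by push_cast; linarith)), Real.sinh_eq,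
    Real.exp_neg]
  push_cast
  set x := Real.exp (2 * kleinDist P Q)
  have : x - 1 ≠ 0 := by linarith
  have : x + 1 ≠ 0 := by linarith
  have : x ≠ 0 := by linarith
  field_simp
  ring

/-- Some `S` on the line has `d(R, S) < Δ₂'`, so `sinh d(R, S) * sinh (2 d(P, Q)) < 1` by
`sinh_Delta_two`. Squaring and bounding `sinh² d(R, S)` below by `triangleDet_sq_mul_le` gives the
claim; the infimum need not be attained. -/
theorem isLow_of_distToLine_lt {P Q R : ℂ} (hP : P ∈ disk) (hQ : Q ∈ disk) (hR : R ∈ disk)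
    (hd : 0 < kleinDist P Q) (h : distToLine P Q R < Delta 2 P Q) : IsLow P Q R := by
  have hne : ((line[ℝ, P, Q] : Set ℂ) ∩ disk).Nonempty :=
    ⟨P, left_mem_affineSpan_pair ℝ P Q, hP⟩
  obtain ⟨_, ⟨S, ⟨hSl, hS⟩, rfl⟩, hlt⟩ := exists_lt_of_csInf_lt (hne.image (kleinDist R)) h
  have hp := lorentz_self_pos hP
  have hq := lorentz_self_pos hQ
  have hr := lorentz_self_pos hR
  have hs := lorentz_self_pos hS
  have c1 := cosh_kleinDist_sq hP hQ
  have c2 := cosh_kleinDist_sq hR hS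
  have hg := triangleDet_sq_mul_le (R := R) hSl
  have hsd := sinh_Delta_two hd
  have h2 : Real.sinh (kleinDist R S) * Real.sinh (2 * kleinDist P Q) < 1 := by
    rw [← hsd]
    exact mul_lt_mul_of_pos_right (Real.sinh_lt_sinh.2 hlt) (Real.sinh_pos_iff.2 (by linarith))
  have h0 : 0 ≤ Real.sinh (kleinDist R S) * Real.sinh (2 * kleinDist P Q) :=
    mul_nonneg (Real.sinh_nonneg_iff.2 (kleinDist_nonneg _ _)) (Real.sinh_nonneg_iff.2 (by linarith))
  have h3 : (Real.sinh (kleinDist R S) * Real.sinh (2 * kleinDist P Q)) ^ 2 < 1 := by nlinarith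
  rw [Real.sinh_two_mul, mul_pow, mul_pow, mul_pow, Real.sinh_sq, Real.sinh_sq] at h3
  have hsc : 0 < Real.cosh (kleinDist P Q) ^ 2 := by have := Real.cosh_pos (kleinDist P Q); positivity
  set c := Real.cosh (kleinDist P Q) ^ 2
  set e := Real.cosh (kleinDist R S) ^ 2
  rw [← c1, ← c2] at hg
  have hg' : triangleDet P Q R ^ 2 ≤
      (e - 1) * (c - 1) * (lorentz R R * lorentz P P * lorentz Q Q) := by
    refine le_of_mul_le_mul_right ?_ hs
    linarith
  unfold IsLow
  rw [← c1]
  set p := lorentz P P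
  set q := lorentz Q Q
  set r := lorentz R R
  calc 4 * (c * (p * q)) * triangleDet P Q R ^ 2
      ≤ 4 * (c * (p * q)) * ((e - 1) * (c - 1) * (r * p * q)) := by gcongr
    _ = (e - 1) * (2 ^ 2 * (c - 1) * c) * (p ^ 2 * q ^ 2 * r) := by ring
    _ < 1 * (p ^ 2 * q ^ 2 * r) := by
      apply mul_lt_mul_of_pos_right _ (by positivity)
      exact h3
    _ = _ := one_mul _

theorem lorentz_sq_of_log_three_lt {P Q : ℂ} (hP : P ∈ disk) (hQ : Q ∈ disk)
    (h : Real.log 3 < kleinDist P Q) :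
    25 * (lorentz P P * lorentz Q Q) < 9 * lorentz P Q ^ 2 := by
  have h1 : Real.cosh (Real.log 3) < Real.cosh (kleinDist P Q) := by
    rw [Real.cosh_lt_cosh, abs_of_pos (Real.log_pos (by norm_num)),
      abs_of_nonneg (kleinDist_nonneg _ _)]
    exact h
  rw [Real.cosh_log (by norm_num)] at h1
  have hpq := mul_pos (lorentz_self_pos hP) (lorentz_self_pos hQ)
  rw [← cosh_kleinDist_sq hP hQ]
  have : 25 / 9 < Real.cosh (kleinDist P Q) ^ 2 := by norm_num at h1; nlinarith
  nlinarith

theorem lorentz_sq_mul_eq_of_isosceles {P Q R : ℂ} (hP : P ∈ disk) (hQ : Q ∈ disk) (hR : R ∈ disk)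
    (hiso : kleinDist P R = kleinDist Q R) :
    lorentz P R ^ 2 * lorentz Q Q = lorentz Q R ^ 2 * lorentz P P := by
  rw [← cosh_kleinDist_sq hP hR, ← cosh_kleinDist_sq hQ hR, hiso]; ring

/-- In a low isosceles triangle with a long base the legs are shorter than the base. -/
theorem leg_le_base {P Q R : ℂ} (hP : P ∈ disk) (hQ : Q ∈ disk) (hR : R ∈ disk)
    (hiso : kleinDist P R = kleinDist Q R) (hlong : Real.log 3 < kleinDist P Q)
    (hlow : IsLow P Q R) :
    lorentz Q R ^ 2 * lorentz P P ≤ lorentz P Q ^ 2 * lorentz R R := by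
  have hp := lorentz_self_pos hP
  have hq := lorentz_self_pos hQ
  have hr := lorentz_self_pos hR
  have hc0 := Real.cosh_pos (kleinDist P Q)
  have c1 := cosh_kleinDist_sq hP hQ
  have c2 := cosh_kleinDist_sq hP hR
  have c3 := cosh_kleinDist_sq hQ hR
  have hb := lorentz_sq_of_log_three_lt hP hQ hlong
  have hG := triangleDet_sq P Q R
  unfold IsLow at hlow
  have hPQ := lorentz_pos hP hQ
  have hPR := lorentz_pos hP hR
  have hQR := lorentz_pos hQ hR
  rw [hiso] at c2
  set c := Real.cosh (kleinDist P Q)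
  set e := Real.cosh (kleinDist Q R)
  set p := lorentz P P
  set q := lorentz Q Q
  set r := lorentz R R
  have hpq := mul_pos hp hq
  have hpqr := mul_pos hpq hr
  have hc : 5 / 3 < c := by
    rw [← c1] at hb
    have : 25 < 9 * c ^ 2 := by nlinarith
    nlinarith
  have hprod : lorentz P Q * lorentz P R * lorentz Q R = c * e ^ 2 * (p * q * r) := by
    have h1 : (lorentz P Q * lorentz P R * lorentz Q R) ^ 2 = (c * e ^ 2 * (p * q * r)) ^ 2 := by
      rw [mul_pow, mul_pow, ← c1, ← c2, ← c3]; ring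
    exact (sq_eq_sq₀ (by positivity) (by positivity)).1 h1
  have hG' : triangleDet P Q R ^ 2 = (1 + 2 * c * e ^ 2 - c ^ 2 - 2 * e ^ 2) * (p * q * r) := by
    rw [hG]
    linear_combination 2 * hprod + p * c3 + q * c2 + r * c1
  rw [← c1, hG'] at hlow
  have h4 : 4 * c ^ 2 * (1 + 2 * c * e ^ 2 - c ^ 2 - 2 * e ^ 2) < 1 := by
    have : 4 * c ^ 2 * (1 + 2 * c * e ^ 2 - c ^ 2 - 2 * e ^ 2) * (p ^ 2 * q ^ 2 * r) <
        1 * (p ^ 2 * q ^ 2 * r) := by linarith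
    exact lt_of_mul_lt_mul_right this (by positivity)
  -- If `e > c`, the bracket in `h4` exceeds `1 + 2 c³ - 3 c² = (c - 1)² (2 c + 1)`, which is far
  -- above `1 / 4` for `c > 5 / 3 = cosh (log 3)`.
  have hec : e ^ 2 ≤ c ^ 2 := by
    by_contra! hlt
    have h5 : 1 + 2 * c * e ^ 2 - c ^ 2 - 2 * e ^ 2 < 1 / 4 := by
      by_contra! h6
      nlinarith
    nlinarith
  rw [← c1, ← c3]
  calc e ^ 2 * (q * r) * p ≤ c ^ 2 * (q * r) * p := by gcongr
    _ = _ := by ring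

theorem IsLow.swap {P Q R : ℂ} (h : IsLow P Q R) : IsLow Q P R := by
  unfold IsLow at *
  have e : triangleDet Q P R ^ 2 = triangleDet P Q R ^ 2 := by
    simp only [triangleDet_eq]; ring
  rw [e, lorentz_comm Q P]; linarith

/-- After normalization, `IsLow` bounds `cosh²` of the chosen side times a quantity symmetric in the
three vertices, so it passes to a shorter side. -/
theorem IsLow.leg {P Q R : ℂ} (hP : P ∈ disk) (hR : R ∈ disk) (h : IsLow P Q R)
    (hle : lorentz Q R ^ 2 * lorentz P P ≤ lorentz P Q ^ 2 * lorentz R R) : IsLow Q R P := by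
  have hp := lorentz_self_pos hP
  have hr := lorentz_self_pos hR
  unfold IsLow at *
  have e : triangleDet Q R P ^ 2 = triangleDet P Q R ^ 2 := by
    simp only [triangleDet_eq]; ring
  rw [e]
  refine lt_of_mul_lt_mul_right (a := lorentz P P) ?_ hp.le
  calc _ = 4 * (lorentz Q R ^ 2 * lorentz P P) * triangleDet P Q R ^ 2 := by ring
    _ ≤ 4 * (lorentz P Q ^ 2 * lorentz R R) * triangleDet P Q R ^ 2 := by gcongr
    _ = (4 * lorentz P Q ^ 2 * triangleDet P Q R ^ 2) * lorentz R R := by ring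
    _ < (lorentz P P ^ 2 * lorentz Q Q ^ 2 * lorentz R R) * lorentz R R :=
      mul_lt_mul_of_pos_right h hr
    _ = _ := by ring

/-- Follows from `cosh² ≥ 1` for the side `PQ`, with a factor 4 to spare. -/
theorem IsLow.triangleDet_sq_lt {P Q R : ℂ} (hP : P ∈ disk) (hQ : Q ∈ disk) (h : IsLow P Q R) :
    triangleDet P Q R ^ 2 < lorentz P P * lorentz Q Q * lorentz R R := by
  have hp := lorentz_self_pos hP
  have hq := lorentz_self_pos hQ
  have hpq := mul_pos hp hq
  have hle := lorentz_mul_self_le P Q hP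
  unfold IsLow at h
  refine lt_of_mul_lt_mul_left (a := lorentz P P * lorentz Q Q) ?_ hpq.le
  nlinarith [sq_nonneg (triangleDet P Q R), mul_le_mul_of_nonneg_right hle (sq_nonneg (triangleDet P Q R))]

/-! ### Lifts of chord maps -/

/-- The covering `x ↦ exp (2 π i x)` of the circle. -/
def cover (x : ℝ) : Circle := Circle.exp (2 * Real.pi * x)

theorem continuous_cover : Continuous cover :=
  Circle.exp.continuous.comp (continuous_const.mul continuous_id)

theorem cover_eq_cover {x y : ℝ} : cover x = cover y ↔ ∃ n : ℤ, x = y + n := by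
  have hpi : 2 * Real.pi ≠ 0 := by positivity
  unfold cover
  rw [Circle.exp_eq_exp]
  refine exists_congr fun n => ⟨fun h => ?_, fun h => ?_⟩
  · apply mul_left_cancel₀ hpi; linear_combination h
  · rw [h]; ring

theorem cover_add_int (x : ℝ) (n : ℤ) : cover (x + n) = cover x := cover_eq_cover.2 ⟨n, rfl⟩

theorem cover_add_one (x : ℝ) : cover (x + 1) = cover x := by
  simpa using cover_add_int x 1

/-- The lift of `v ↦ secondPoint v (θ v)` that moves each point by less than one turn. -/
def slopeLift (θ : Circle → ℝ) (x : ℝ) : ℝ :=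
  x + 1 / 2 + Real.arctan (θ (cover x)) / Real.pi

/-- By the inscribed angle theorem, the chord of gradient `t` from `v` ends at angle `π + 2 arctan
t` from `v`. -/
theorem cover_slopeLift (θ : Circle → ℝ) (x : ℝ) :
    cover (slopeLift θ x) = secondPoint (cover x) (θ (cover x)) := by
  set t := θ (cover x) with ht
  have hpi := Real.pi_ne_zero
  have h1 : 2 * Real.pi * slopeLift θ x =
      2 * Real.pi * x + (Real.pi + 2 * Real.arctan t) := by
    rw [slopeLift, ← ht]; field_simp; ring
  have hc : Real.cos (Real.arctan t) ^ 2 = 1 / (1 + t ^ 2) := Real.cos_sq_arctan t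
  have hs : Real.sin (Real.arctan t) = t * Real.cos (Real.arctan t) := by
    rw [Real.sin_arctan, Real.cos_arctan]; ring
  have h2 : Real.cos (Real.pi + 2 * Real.arctan t) = 1 - 2 / (1 + t ^ 2) := by
    rw [Real.cos_add, Real.cos_pi, Real.sin_pi, Real.cos_two_mul, hc]; ring
  have h3 : Real.sin (Real.pi + 2 * Real.arctan t) = - 2 / (1 + t ^ 2) * t := by
    rw [Real.sin_add, Real.cos_pi, Real.sin_pi, Real.sin_two_mul, hs]
    linear_combination (-2 * t) * hc
  apply Circle.ext
  rw [cover, h1, Circle.exp_add, Circle.coe_mul]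
  change (cover x : ℂ) * _ = _
  have h4 : ((Circle.exp (Real.pi + 2 * Real.arctan t) : Circle) : ℂ) =
      (1 - 2 / (1 + t ^ 2) : ℝ) + (- 2 / (1 + t ^ 2) * t : ℝ) * Complex.I := by
    rw [Circle.coe_exp, Complex.exp_mul_I, ← Complex.ofReal_cos, ← Complex.ofReal_sin, h2, h3]
  rw [h4]
  simp only [secondPoint]
  push_cast
  ring

theorem lt_slopeLift (θ : Circle → ℝ) (x : ℝ) : x < slopeLift θ x := by
  have h := Real.neg_pi_div_two_lt_arctan (θ (cover x))
  have : -(1 / 2) < Real.arctan (θ (cover x)) / Real.pi := by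
    rw [lt_div_iff₀ Real.pi_pos]; linarith
  rw [slopeLift]; linarith

theorem slopeLift_lt (θ : Circle → ℝ) (x : ℝ) : slopeLift θ x < x + 1 := by
  have h := Real.arctan_lt_pi_div_two (θ (cover x))
  have : Real.arctan (θ (cover x)) / Real.pi < 1 / 2 := by
    rw [div_lt_iff₀ Real.pi_pos]; linarith
  rw [slopeLift]; linarith

theorem slopeLift_add_one (θ : Circle → ℝ) (x : ℝ) :
    slopeLift θ (x + 1) = slopeLift θ x + 1 := by
  rw [slopeLift, slopeLift, cover_add_one]; ring

theorem continuous_slopeLift {θ : Circle → ℝ} (h : Continuous θ) : Continuous (slopeLift θ) := by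
  have := Real.continuous_arctan.comp (h.comp continuous_cover)
  exact (continuous_id.add continuous_const).add (this.div_const _)

theorem slopeLift_min (θ η : Circle → ℝ) (x : ℝ) :
    slopeLift (fun v => min (θ v) (η v)) x = min (slopeLift θ x) (slopeLift η x) := by
  have : Monotone fun t : ℝ => x + 1 / 2 + Real.arctan t / Real.pi := fun s t hst => by
    have := Real.arctan_mono hst
    have := Real.pi_pos
    dsimp only
    gcongr
  exact this.map_min

/-! ### The involution of the circle defined by a point -/

theorem re_mul_conj_lt_one {u : ℂ} (hu : u ∈ disk) (v : Circle) :
    (u * conj (v : ℂ)).re < 1 := by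
  have h : ‖u‖ < 1 := by simpa [disk] using hu
  calc (u * conj (v : ℂ)).re ≤ ‖u * conj (v : ℂ)‖ := Complex.re_le_norm _
    _ = ‖u‖ := by rw [norm_mul, Complex.norm_conj, Circle.norm_coe, mul_one]
    _ < 1 := h

theorem coe_mul_conj (v : Circle) : (v : ℂ) * conj (v : ℂ) = 1 := by
  rw [Complex.mul_conj, Circle.normSq_coe]; norm_num

/-- The lift of the involution of the circle that exchanges the ends of the chords through `u`. -/
def pointLift (u : ℂ) : ℝ → ℝ := slopeLift (chordGradient u)

theorem continuous_chordGradient {u : ℂ} (hu : u ∈ disk) : Continuous (chordGradient u) := by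
  have h : Continuous fun v : Circle => u * conj (v : ℂ) :=
    continuous_const.mul (Complex.continuous_conj.comp continuous_subtype_val)
  exact (Complex.continuous_im.comp h).div
    ((Complex.continuous_re.comp h).sub continuous_const)
    fun v => (sub_neg.2 (re_mul_conj_lt_one hu v)).ne

/-- The chord involution is the Möbius map `v ↦ (u - v) / (1 - conj u * v)`; the division is
avoided. -/
theorem secondPoint_chordGradient {u : ℂ} (hu : u ∈ disk) (v : Circle) :
    (secondPoint v (chordGradient u v) : ℂ) * (1 - conj u * v) = u - v := by
  have hlt := re_mul_conj_lt_one hu v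
  have hv := coe_mul_conj v
  have hu : u = u * conj (v : ℂ) * v := by linear_combination (-u) * hv
  set w := u * conj (v : ℂ) with hw
  have hw' : conj u * v = conj w := by rw [hw, map_mul, Complex.conj_conj]
  have hg : chordGradient u v = w.im / (w.re - 1) := rfl
  rw [hw', hg]
  simp only [secondPoint]
  have h1 : w.re - 1 ≠ 0 := by linarith
  set t := w.im / (w.re - 1) with ht
  set r := -2 / (1 + t ^ 2) with hr
  have ht' : t * (w.re - 1) = w.im := by rw [ht]; field_simp
  have hr' : r * (1 + t ^ 2) = -2 := by rw [hr]; field_simp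
  have h3 : (1 + (r : ℂ) * (1 + (t : ℂ) * Complex.I)) * (1 - conj w) = w - 1 := by
    apply Complex.ext
    · simp
      linear_combination (1 - w.re) * hr' + r * t * ht'
    · simp
      linear_combination -r * ht'
  rw [hu]
  linear_combination (v : ℂ) * h3

theorem cover_pointLift {u : ℂ} (hu : u ∈ disk) (x : ℝ) :
    (cover (pointLift u x) : ℂ) * (1 - conj u * cover x) = u - cover x := by
  rw [pointLift, cover_slopeLift]
  exact secondPoint_chordGradient hu _

theorem one_sub_conj_mul_ne_zero {u : ℂ} (hu : u ∈ disk) (v : Circle) :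
    1 - conj u * (v : ℂ) ≠ 0 := by
  intro h
  have h1 := congrArg Complex.re h
  have h2 := re_mul_conj_lt_one hu v
  simp at h1 h2
  linarith

theorem pointLift_pointLift {u : ℂ} (hu : u ∈ disk) (x : ℝ) :
    pointLift u (pointLift u x) = x + 1 := by
  have h1 := cover_pointLift hu x
  have h2 := cover_pointLift hu (pointLift u x)
  have h3 := one_sub_conj_mul_ne_zero hu (cover (pointLift u x))
  have h4 : cover (pointLift u (pointLift u x)) = cover x := by
    apply Circle.ext
    apply mul_right_cancel₀ h3
    linear_combination h2 - h1
  obtain ⟨n, hn⟩ := cover_eq_cover.1 h4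
  have a1 := lt_slopeLift (chordGradient u) x
  have a2 := slopeLift_lt (chordGradient u) x
  have a3 := lt_slopeLift (chordGradient u) (slopeLift (chordGradient u) x)
  have a4 := slopeLift_lt (chordGradient u) (slopeLift (chordGradient u) x)
  rw [hn]
  unfold pointLift at hn
  have b1 : (0 : ℝ) < n := by linarith
  have b2 : (n : ℝ) < 2 := by linarith
  have c1 : 0 < n := by exact_mod_cast b1
  have c2 : n < 2 := by exact_mod_cast b2
  have : n = 1 := by omega
  simp [this]

theorem continuous_pointLift {u : ℂ} (hu : u ∈ disk) : Continuous (pointLift u) :=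
  continuous_slopeLift (continuous_chordGradient hu)

theorem pointLift_add_one (u : ℂ) (x : ℝ) : pointLift u (x + 1) = pointLift u x + 1 :=
  slopeLift_add_one _ x

theorem lt_pointLift (u : ℂ) (x : ℝ) : x < pointLift u x := lt_slopeLift _ x

theorem strictMono_pointLift {u : ℂ} (hu : u ∈ disk) : StrictMono (pointLift u) := by
  have hinj : Function.Injective (pointLift u) := fun x y h => by
    have := congrArg (pointLift u) h
    rw [pointLift_pointLift hu, pointLift_pointLift hu] at this
    linarith
  refine ((continuous_pointLift hu).strictMono_of_inj hinj).resolve_right fun h => ?_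
  have h1 := h (zero_lt_one' ℝ)
  have h2 := pointLift_add_one u 0
  rw [zero_add] at h2
  linarith

/-- For two points of the disk, some line through the first passes through the second. -/
theorem exists_pointLift_eq {b c : ℂ} (hb : b ∈ disk) (hc : c ∈ disk) :
    ∃ y, pointLift b y = pointLift c y := by
  by_contra! hne
  -- A strict inequality everywhere would also be strict between the squares, but both squares are
  -- `x ↦ x + 1`.
  have aux : ∀ {b c : ℂ}, b ∈ disk → c ∈ disk → ¬ ∀ y, pointLift b y < pointLift c y := by
    intro b c hb hc h
    have h1 := h (pointLift b 0)
    have h2 := strictMono_pointLift hc (h 0)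
    rw [pointLift_pointLift hb] at h1
    rw [pointLift_pointLift hc] at h2
    linarith
  have h1 := aux hb hc
  have h2 := aux hc hb
  push Not at h1 h2
  obtain ⟨y, hy⟩ := h1
  obtain ⟨z, hz⟩ := h2
  obtain ⟨x, hx⟩ := intermediate_value_univ₂ (continuous_pointLift hb) (continuous_pointLift hc)
    hz hy
  exact hne x hx

/-! ### Möbius transformations of the circle -/

/-- The map `H` of the line lifts the Möbius transformation of the circle with matrix
`(α, β; conj β, conj α)`. -/
def Represents (H : ℝ → ℝ) (α β : ℂ) : Prop :=
  ∀ x, (cover (H x) : ℂ) * (conj β * cover x + conj α) = α * cover x + β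

/-- The factor `-I` brings the matrix `(1, -u; conj u, -1)` to the required conjugate-symmetric
form; the trace is `0`, as for a half-turn. -/
theorem represents_pointLift {u : ℂ} (hu : u ∈ disk) :
    Represents (pointLift u) (-Complex.I) (Complex.I * u) := fun x => by
  have := cover_pointLift hu x
  simp only [map_mul, map_neg, Complex.conj_I]
  linear_combination Complex.I * this

theorem Represents.comp {H K : ℝ → ℝ} {α β γ δ : ℂ} (hH : Represents H α β)
    (hK : Represents K γ δ) :
    Represents (H ∘ K) (α * γ + β * conj δ) (α * δ + β * conj γ) := fun x => by
  have h1 := hH (K x)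
  have h2 := hK x
  simp only [Function.comp, map_add, map_mul, Complex.conj_conj]
  linear_combination (conj γ + conj δ * (cover x : ℂ)) * h1 +
    (α - conj β * (cover (H (K x)) : ℂ)) * h2

theorem normSq_sub_normSq_comp (α β γ δ : ℂ) :
    Complex.normSq (α * γ + β * conj δ) - Complex.normSq (α * δ + β * conj γ) =
      (Complex.normSq α - Complex.normSq β) * (Complex.normSq γ - Complex.normSq δ) := by
  simp only [Complex.normSq_apply, Complex.add_re, Complex.add_im, Complex.mul_re, Complex.mul_im,
    Complex.conj_re, Complex.conj_im]
  ring

/-- An elliptic transformation has no fixed point on the circle. -/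
theorem Represents.ne_add_int {H : ℝ → ℝ} {α β : ℂ} (hH : Represents H α β)
    (hell : α.re ^ 2 < Complex.normSq α - Complex.normSq β) (x : ℝ) (n : ℤ) : H x ≠ x + n := by
  intro h
  have h1 := hH x
  rw [h, cover_add_int] at h1
  have hv := coe_mul_conj (cover x)
  set v : ℂ := (cover x : ℂ)
  have h2 : conj β * v + conj α = α + β * conj v := by
    linear_combination conj v * h1 + (α - conj β * v - conj α) * hv
  -- At a fixed point `|Im α| ≤ |β|`, hence `|α|² - |β|² ≤ (Re α)²`, against ellipticity.
  have h3 : (conj β * v).im = α.im := by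
    have := congrArg Complex.im h2
    simp at this ⊢
    linarith
  have h4 : Complex.normSq (conj β * v) = Complex.normSq β := by
    rw [Complex.normSq_mul, Complex.normSq_conj, Circle.normSq_coe, mul_one]
  rw [Complex.normSq_apply, h3] at h4
  rw [Complex.normSq_apply α] at hell
  nlinarith [mul_self_nonneg (conj β * v).re]

/-- Without fixed points `H x - x` never meets an integer, so a bound at one point spreads by the
intermediate value theorem. -/
theorem Represents.add_int_lt {H : ℝ → ℝ} {α β : ℂ} (hH : Represents H α β)
    (hell : α.re ^ 2 < Complex.normSq α - Complex.normSq β) (hc : Continuous H) {y : ℝ} {n : ℤ}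
    (hy : y + n < H y) (x : ℝ) : x + n < H x := by
  by_contra! h
  obtain ⟨z, hz⟩ := intermediate_value_univ₂ hc (continuous_id.add_const (n : ℝ)) h hy.le
  exact hH.ne_add_int hell z n hz

theorem represents_pointLift_pair {b c : ℂ} (hb : b ∈ disk) (hc : c ∈ disk) :
    Represents (pointLift b ∘ pointLift c) (-1 + b * conj c) (c - b) := by
  convert (represents_pointLift hb).comp (represents_pointLift hc) using 1
  · simp only [map_mul, Complex.conj_I]; linear_combination (b * conj c - 1) * Complex.I_mul_I
  · simp only [map_neg, Complex.conj_I]; linear_combination (c - b) * Complex.I_mul_I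

theorem normSq_pair (b c : ℂ) : Complex.normSq (-1 + b * conj c) - Complex.normSq (c - b) =
    lorentz b b * lorentz c c := by
  simp [Complex.normSq_apply, lorentz_eq]; ring

theorem normSq_point (a : ℂ) :
    Complex.normSq (-Complex.I) - Complex.normSq (Complex.I * a) = lorentz a a := by
  simp [Complex.normSq_apply, lorentz_eq]; ring

/-- The product of three half-turns exceeds one turn, if it is elliptic. -/
theorem add_one_lt_of_triangleDet {a b c : ℂ} (ha : a ∈ disk) (hb : b ∈ disk) (hc : c ∈ disk)
    (h : triangleDet a b c ^ 2 < lorentz a a * lorentz b b * lorentz c c) (x : ℝ) :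
    x + 1 < pointLift a (pointLift b (pointLift c x)) := by
  obtain ⟨y, hy⟩ := exists_pointLift_eq hb hc
  have hrep := (represents_pointLift ha).comp (represents_pointLift_pair hb hc)
  have hcont : Continuous (pointLift a ∘ pointLift b ∘ pointLift c) :=
    (continuous_pointLift ha).comp ((continuous_pointLift hb).comp (continuous_pointLift hc))
  have := hrep.add_int_lt (y := y) (n := 1) ?_ hcont ?_ x
  · simpa using this
  · rw [normSq_sub_normSq_comp, normSq_point, normSq_pair, ← mul_assoc]
    convert h using 2
    simp [triangleDet_eq]; ring
  -- At `y`, an end of a chord through `b` and `c`, the two half-turns cancel up to a whole turn,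
  -- and `a` adds a positive amount.
  · simp only [Function.comp, ← hy]
    rw [pointLift_pointLift hb, pointLift_add_one]
    have := lt_pointLift a y
    push_cast; linarith

/-- The product of a half-turn and the square of the product of two half-turns exceeds two turns,
if it is elliptic. -/
theorem IsLow.add_two_lt {a b c : ℂ} (ha : a ∈ disk) (hb : b ∈ disk) (hc : c ∈ disk)
    (h : IsLow b c a) (x : ℝ) :
    x + 2 < pointLift a (pointLift b (pointLift c (pointLift b (pointLift c x)))) := by
  obtain ⟨y, hy⟩ := exists_pointLift_eq hb hc
  have hbc := represents_pointLift_pair hb hc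
  have hrep := (represents_pointLift ha).comp (hbc.comp hbc)
  have hc2 := (continuous_pointLift hb).comp (continuous_pointLift hc)
  have hcont : Continuous (pointLift a ∘ (pointLift b ∘ pointLift c) ∘
    (pointLift b ∘ pointLift c)) := (continuous_pointLift ha).comp (hc2.comp hc2)
  have := hrep.add_int_lt (y := y) (n := 2) ?_ hcont ?_ x
  · simpa using this
  · rw [normSq_sub_normSq_comp, normSq_sub_normSq_comp, normSq_point, normSq_pair]
    unfold IsLow at h
    have e1 : lorentz a a * (lorentz b b * lorentz c c * (lorentz b b * lorentz c c)) =
      lorentz b b ^ 2 * lorentz c c ^ 2 * lorentz a a := by ring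
    -- The number being squared is the real part of the `α`-entry, half the trace of the word.
    have e2 : 4 * lorentz b c ^ 2 * triangleDet b c a ^ 2 =
      (-(2 * lorentz b c * triangleDet b c a)) ^ 2 := by ring
    rw [e1]
    rw [e2] at h
    convert h using 2
    simp [triangleDet_eq, lorentz_eq]; ring
  · simp only [Function.comp]
    have h1 : pointLift b (pointLift c y) = y + 1 := by rw [← hy, pointLift_pointLift hb]
    rw [h1, pointLift_add_one, pointLift_add_one, h1, pointLift_add_one, pointLift_add_one]
    have := lt_pointLift a y
    push_cast; linarith

/-! ### The bar billiard map of a triangle -/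

theorem le_chordGradient_iff {u : ℂ} (hu : u ∈ disk) (v : Circle) (m : ℝ) :
    m ≤ chordGradient u v ↔
      (u * conj (v : ℂ)).im - m * (u * conj (v : ℂ)).re ≤ -m := by
  have := re_mul_conj_lt_one hu v
  rw [chordGradient, le_div_iff_of_neg (by linarith)]
  constructor <;> intro h <;> linarith

/-- Within the disk, the points of gradient at least `m` form a half-plane, so the bound at the
vertices passes to their convex hull. -/
theorem minGradient_triangle {P Q R : ℂ} (hP : P ∈ disk) (hQ : Q ∈ disk) (hR : R ∈ disk)
    (v : Circle) : minGradient (convexHull ℝ {P, Q, R}) v =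
      min (min (chordGradient P v) (chordGradient Q v)) (chordGradient R v) := by
  set m := min (min (chordGradient P v) (chordGradient Q v)) (chordGradient R v) with hm
  have hsub : ({P, Q, R} : Set ℂ) ⊆ convexHull ℝ {P, Q, R} := subset_convexHull ℝ _
  have hleast : IsLeast ((fun u => chordGradient u v) '' convexHull ℝ {P, Q, R}) m := by
    constructor
    · have hmem : ∀ u ∈ ({P, Q, R} : Set ℂ), chordGradient u v ∈
          (fun u => chordGradient u v) '' convexHull ℝ {P, Q, R} := fun u hu => ⟨u, hsub hu, rfl⟩
      rcases min_choice (min (chordGradient P v) (chordGradient Q v)) (chordGradient R v) with h | h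
      · rcases min_choice (chordGradient P v) (chordGradient Q v) with h' | h'
        · rw [hm, h, h']; exact hmem P (by simp)
        · rw [hm, h, h']; exact hmem Q (by simp)
      · rw [hm, h]; exact hmem R (by simp)
    · have hlin : IsLinearMap ℝ fun u : ℂ =>
          (u * conj (v : ℂ)).im - m * (u * conj (v : ℂ)).re := by
        constructor
        · intro x y; simp; ring
        · intro c x; simp; ring
      have hconv : Convex ℝ (disk ∩ {u : ℂ | (u * conj (v : ℂ)).im -
          m * (u * conj (v : ℂ)).re ≤ -m}) :=
        (convex_ball (0 : ℂ) 1).inter (convex_halfSpace_le hlin _)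
      have hle := convexHull_min (s := {P, Q, R}) (by
        rintro u (rfl | rfl | rfl)
        · exact ⟨hP, (le_chordGradient_iff hP v m).1 ((min_le_left _ _).trans (min_le_left _ _))⟩
        · exact ⟨hQ, (le_chordGradient_iff hQ v m).1 ((min_le_left _ _).trans (min_le_right _ _))⟩
        · exact ⟨hR, (le_chordGradient_iff hR v m).1 (min_le_right _ _)⟩) hconv
      rintro _ ⟨u, hu, rfl⟩
      exact (le_chordGradient_iff (hle hu).1 v m).2 (hle hu).2
  exact hleast.csInf_eq

/-- The lift of the bar billiard map of the triangle `PQR`. -/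
def triangleLift (P Q R : ℂ) : ℝ → ℝ := slopeLift (minGradient (convexHull ℝ {P, Q, R}))

theorem triangleLift_eq {P Q R : ℂ} (hP : P ∈ disk) (hQ : Q ∈ disk) (hR : R ∈ disk) (x : ℝ) :
    triangleLift P Q R x = min (min (pointLift P x) (pointLift Q x)) (pointLift R x) := by
  have : minGradient (convexHull ℝ {P, Q, R}) = fun v =>
      min (min (chordGradient P v) (chordGradient Q v)) (chordGradient R v) :=
    funext fun v => minGradient_triangle hP hQ hR v
  rw [triangleLift, this, slopeLift_min, slopeLift_min]
  rfl

theorem continuous_triangleLift {P Q R : ℂ} (hP : P ∈ disk) (hQ : Q ∈ disk) (hR : R ∈ disk) :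
    Continuous (triangleLift P Q R) := by
  rw [funext (triangleLift_eq hP hQ hR)]
  exact ((continuous_pointLift hP).min (continuous_pointLift hQ)).min (continuous_pointLift hR)

theorem strictMono_triangleLift {P Q R : ℂ} (hP : P ∈ disk) (hQ : Q ∈ disk) (hR : R ∈ disk) :
    StrictMono (triangleLift P Q R) := fun x y h => by
  rw [triangleLift_eq hP hQ hR, triangleLift_eq hP hQ hR]
  exact min_lt_min (min_lt_min (strictMono_pointLift hP h) (strictMono_pointLift hQ h))
    (strictMono_pointLift hR h)

theorem isNormalizedLift_triangleLift {P Q R : ℂ} (hP : P ∈ disk) (hQ : Q ∈ disk)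
    (hR : R ∈ disk) :
    IsNormalizedLift (billiardMap (convexHull ℝ {P, Q, R})) (triangleLift P Q R) where
  continuous := continuous_triangleLift hP hQ hR
  strictMono := strictMono_triangleLift hP hQ hR
  map_add_one := slopeLift_add_one _
  map_zero_mem := ⟨(lt_slopeLift _ 0).le, (slopeLift_lt _ 0).trans_eq (zero_add 1)⟩
  semiconj x := cover_slopeLift _ x

/-! ### Words in three half-turns -/

/-- Words of length five in three lifted involutions move every point by more than two turns, if
this holds for words `i j k j k` and words of length three move every point by more than one
turn. -/
theorem add_two_lt_word {f : Fin 3 → ℝ → ℝ} (hmono : ∀ i, StrictMono (f i))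
    (hinv : ∀ i x, f i (f i x) = x + 1) (hadd : ∀ i x, f i (x + 1) = f i x + 1)
    (h3 : ∀ i j k x, x + 1 < f i (f j (f k x)))
    (h5 : ∀ i j k x, x + 2 < f i (f j (f k (f j (f k x))))) (i j k l m : Fin 3) (x : ℝ) :
    x + 2 < f i (f j (f k (f l (f m x)))) := by
  -- Conjugation by `f i`, whose inverse is `x ↦ f i x - 1`, moves the last letter to the front.
  have hrot : ∀ (i : Fin 3) (G : ℝ → ℝ), (∀ y, y + 2 < G (f i y)) → ∀ x, x + 2 < f i (G x) := by
    intro i G h x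
    have e1 : f i (f i x - 1) = x := by
      have := hadd i (f i x - 1)
      rw [sub_add_cancel, hinv] at this
      linarith
    have e2 : f i (f i x - 1 + 2) = x + 2 := by
      rw [show f i x - 1 + 2 = f i x - 1 + 1 + 1 by ring, hadd, hadd, e1]; ring
    have := hmono i (h (f i x - 1))
    rwa [e1, e2] at this
  have hbase : ∀ i j k l m : Fin 3, (i = j ∨ (j = l ∧ k = m)) →
      ∀ x, x + 2 < f i (f j (f k (f l (f m x)))) := by
    rintro i j k l m (rfl | ⟨rfl, rfl⟩) x
    · rw [hinv]; linarith [h3 k l m x]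
    · exact h5 i j k x
  -- With no two cyclically adjacent letters equal, one letter occurs once and the other two
  -- alternate; the five alternatives are the cyclic rotations.
  have hcases : ∀ i j k l m : Fin 3, (i = j ∨ (j = l ∧ k = m)) ∨ (j = k ∨ (k = m ∧ l = i)) ∨
      (k = l ∨ (l = i ∧ m = j)) ∨ (l = m ∨ (m = j ∧ i = k)) ∨ (m = i ∨ (i = k ∧ j = l)) := by
    decide
  have r : ∀ i j k l m : Fin 3, (∀ x, x + 2 < f j (f k (f l (f m (f i x))))) →
      ∀ x, x + 2 < f i (f j (f k (f l (f m x)))) := fun i j k l m =>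
    hrot i fun x => f j (f k (f l (f m x)))
  rcases hcases i j k l m with h | h | h | h | h
  · exact hbase _ _ _ _ _ h x
  · exact r _ _ _ _ _ (hbase _ _ _ _ _ h) x
  · exact r _ _ _ _ _ (r _ _ _ _ _ (hbase _ _ _ _ _ h)) x
  · exact r _ _ _ _ _ (r _ _ _ _ _ (r _ _ _ _ _ (hbase _ _ _ _ _ h))) x
  · exact r _ _ _ _ _ (r _ _ _ _ _ (r _ _ _ _ _ (r _ _ _ _ _ (hbase _ _ _ _ _ h)))) x

/-- Covers the triples with a repeated vertex, since the words are over arbitrary letters. -/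
theorem isLow_of_triangleDet_eq_zero {P Q R : ℂ} (hP : P ∈ disk) (hQ : Q ∈ disk) (hR : R ∈ disk)
    (h : triangleDet P Q R = 0) : IsLow P Q R := by
  have := lorentz_self_pos hP
  have := lorentz_self_pos hQ
  have := lorentz_self_pos hR
  rw [IsLow, h, zero_pow two_ne_zero, mul_zero]
  positivity

/-- If every side of a triangle is low, then the fifth power of the lift of its bar billiard map
exceeds two turns. -/
theorem add_two_lt_iterate_triangleLift {P Q R : ℂ} (hP : P ∈ disk) (hQ : Q ∈ disk)
    (hR : R ∈ disk) (hPQR : IsLow P Q R) (hQRP : IsLow Q R P) (hPRQ : IsLow P R Q) (x : ℝ) :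
    x + 2 < (triangleLift P Q R)^[5] x := by
  set p : Fin 3 → ℂ := ![P, Q, R]
  have hp : ∀ i, p i ∈ disk := by
    intro i; fin_cases i <;> assumption
  have hlow : ∀ i j k, IsLow (p i) (p j) (p k) := by
    intro i j k
    by_cases h : i = j ∨ j = k ∨ k = i
    · apply isLow_of_triangleDet_eq_zero (hp i) (hp j) (hp k)
      rcases h with rfl | rfl | rfl <;> simp only [triangleDet_eq] <;> ring
    · fin_cases i <;> fin_cases j <;> fin_cases k <;>
        first
        | exact absurd (by decide) h
        | assumption
        | exact hPQR.swap
        | exact hQRP.swap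
        | exact hPRQ.swap
  have hw := add_two_lt_word (f := fun i => pointLift (p i))
    (fun i => strictMono_pointLift (hp i)) (fun i => pointLift_pointLift (hp i))
    (fun i => pointLift_add_one (p i))
    (fun i j k => add_one_lt_of_triangleDet (hp i) (hp j) (hp k)
      ((hlow i j k).triangleDet_sq_lt (hp i) (hp j)))
    (fun i j k => (hlow j k i).add_two_lt (hp i) (hp j) (hp k))
  have hmem : ∀ x, ∃ i, triangleLift P Q R x = pointLift (p i) x := by
    intro x
    rw [triangleLift_eq hP hQ hR]
    rcases min_choice (min (pointLift P x) (pointLift Q x)) (pointLift R x) with h | h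
    · rcases min_choice (pointLift P x) (pointLift Q x) with h' | h'
      · exact ⟨0, h.trans h'⟩
      · exact ⟨1, h.trans h'⟩
    · exact ⟨2, h⟩
  simp only [Function.iterate_succ, Function.iterate_zero, Function.comp, id]
  obtain ⟨m, h1⟩ := hmem x
  rw [h1]
  obtain ⟨l, h2⟩ := hmem (pointLift (p m) x)
  rw [h2]
  obtain ⟨k, h3⟩ := hmem (pointLift (p l) (pointLift (p m) x))
  rw [h3]
  obtain ⟨j, h4⟩ := hmem (pointLift (p k) (pointLift (p l) (pointLift (p m) x)))
  rw [h4]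
  obtain ⟨i, h5⟩ := hmem (pointLift (p j) (pointLift (p k) (pointLift (p l) (pointLift (p m) x))))
  rw [h5]
  exact hw i j k l m x

/-- The strict bound survives in the limit because `F^[n] x - x` is continuous and periodic, hence
bounded away from `k`. -/
theorem exists_hasRotationNumber_gt {f : Circle → Circle} {F : ℝ → ℝ} (hF : IsNormalizedLift f F)
    {n : ℕ} (hn : 0 < n) {k : ℤ} (h : ∀ x, x + k < F^[n] x) :
    ∃ ρ : ℝ, HasRotationNumber f ρ ∧ (k : ℝ) / n < ρ := by
  let φ : CircleDeg1Lift := ⟨⟨F, hF.strictMono.monotone⟩, hF.map_add_one⟩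
  have hφ : ∀ n : ℕ, ⇑(φ ^ n) = F^[n] := fun n => CircleDeg1Lift.coe_pow φ n
  refine ⟨φ.translationNumber, ⟨F, hF, fun x => ?_⟩, ?_⟩
  · simpa only [hφ] using φ.tendsto_translationNumber x
  · have h1 := (φ ^ n).lt_translationNumber_of_forall_add_lt (z := k)
      (CircleDeg1Lift.continuous_pow φ hF.continuous n) (by rw [hφ]; exact h)
    rw [CircleDeg1Lift.translationNumber_pow] at h1
    rw [div_lt_iff₀ (by exact_mod_cast hn)]
    linarith

end BarBilliard

end

theorem theorem6p1 (P Q R : ℂ)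
    (hP : P ∈ BarBilliard.disk) (hQ : Q ∈ BarBilliard.disk) (hR : R ∈ BarBilliard.disk)
    (hPQR : AffineIndependent ℝ ![P, Q, R])
    (hiso : BarBilliard.kleinDist P R = BarBilliard.kleinDist Q R)
    (hlong : Real.log 3 < BarBilliard.kleinDist P Q)
    (hlow : BarBilliard.distToLine P Q R < BarBilliard.Delta 2 P Q) :
    ∃ ρ : ℝ, BarBilliard.HasRotationNumber
        (BarBilliard.billiardMap (convexHull ℝ {P, Q, R})) ρ ∧
      2 / 5 < ρ := by
  have hpos := (Real.log_pos (by norm_num : (1 : ℝ) < 3)).trans hlong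
  have h1 := BarBilliard.isLow_of_distToLine_lt hP hQ hR hpos hlow
  have hle := BarBilliard.leg_le_base hP hQ hR hiso hlong h1
  have hlegs := BarBilliard.lorentz_sq_mul_eq_of_isosceles hP hQ hR hiso
  have h2 := h1.leg hP hR hle
  -- The other leg is no longer than the base because it equals the first.
  have h3 := h1.swap.leg hQ hR (by
    rw [hlegs, BarBilliard.lorentz_comm Q P]; exact hle)
  obtain ⟨ρ, hρ, hlt⟩ := BarBilliard.exists_hasRotationNumber_gt
    (BarBilliard.isNormalizedLift_triangleLift hP hQ hR) (n := 5) (k := 2) (by norm_num)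
    (fun x => by
      exact_mod_cast BarBilliard.add_two_lt_iterate_triangleLift hP hQ hR h1 h2 h3 x)
  exact ⟨ρ, hρ, by simpa using hlt⟩
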